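/- For $n\ge 1$ let $L_n$ be the ladder graph of order $2n$, with vertices $u_1^{\pm},\dots,u_n^{\pm}$, edges $u_i^{\varepsilon}u_{i+1}^{\varepsilon}$ for $1\le i\le n-1$, $\varepsilon=\pm$, and spokes $u_i^+u_i^-$ for $1\le i\le n$. Let $CL_n$ be the circular ladder graph of order $2n$, with the same vertices, one edge $e_i^{\varepsilon}$ joining $u_i^{\varepsilon}$ to $u_{i+1}^{\varepsilon}$ for each $1\le i\le n$ and $\varepsilon=\pm$ (indices modulo $n$), and spokes $u_i^+u_i^-$ for $1\le i\le n$; it is a simple graph for $n\ge 3$, has parallel edges for $n=2$, and has a loop at each vertex for $n=1$. For a multigraph $\Gamma$ let $s(\Gamma)$ be the number of its spanning trees and, for an edge $f$, let $\Gamma/f$ be the multigraph obtained by contracting $f$ (all other edges are kept). Let $(s_n)_{n\ge 0}$ be the sequence with $s_0=0$, $s_1=1$ and $s_n=4s_{n-1}-s_{n-2}$ for $n\ge 2$. Then, for every $n\ge 1$ and every spoke $f$ of $CL_n$, \[ s(CL_n/f)=n\,s(L_n)\qquad\text{and}\qquad s(L_n)=s_n, \] so that $s(CL_n/f)=n\,s_n$.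 -/

import Mathlib

/-- A multigraph is connected if it has a vertex and any two of its vertices are joined by a
walk. -/
def Graph.IsConn {α β : Type*} (G : Graph α β) : Prop :=
  G.vertexSet.Nonempty ∧
    ∀ x ∈ G.vertexSet, ∀ y ∈ G.vertexSet, Relation.ReflTransGen G.Adj x y

/-- A multigraph has a cycle if for some length `k + 1 ≥ 1` there are distinct vertices
`v 0, …, v k` and distinct edges `e 0, …, e k` such that `e i` joins `v i` to `v (i + 1)`, indices
being taken modulo `k + 1`. Length one is a loop, length two a pair of parallel edges. -/
def Graph.HasCycle {α β : Type*} (G : Graph α β) : Prop :=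
  ∃ (k : ℕ) (v : Fin (k + 1) → α) (e : Fin (k + 1) → β),
    Function.Injective v ∧ Function.Injective e ∧ ∀ i, G.IsLink (e i) (v i) (v (i + 1))

/-- A tree is a connected multigraph without cycles. -/
def Graph.IsTreeGraph {α β : Type*} (G : Graph α β) : Prop :=
  G.IsConn ∧ ¬ G.HasCycle

/-- The set of spanning trees of `G`: the subgraphs on all vertices of `G` that are trees. -/
def Graph.spanningTrees {α β : Type*} (G : Graph α β) : Set (Graph α β) :=
  {T | T.IsSpanningSubgraph G ∧ T.IsTreeGraph}

/-- The number of spanning trees of `G`. -/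
noncomputable def Graph.numSpanningTrees {α β : Type*} (G : Graph α β) : ℕ :=
  G.spanningTrees.ncard

/-- The contraction of an edge `e`: `e` is deleted and its two ends are identified. All other
edges are kept, including any that become parallel edges or loops. -/
def Graph.contractEdge {α β : Type*} (G : Graph α β) (e : β) : Graph (Quot (G.IsLink e)) β :=
  (G.deleteEdges {e}).map (Quot.mk (G.IsLink e))

/-- Labels for the edges of ladders with `n` spokes: `rail i ε` starts at the vertex `(i, ε)` and
leads to the next vertex on the same side, `spoke i` joins the two sides at position `i`. -/
inductive LadderEdge (n : ℕ) : Type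
  | rail (i : Fin n) (ε : Bool)
  | spoke (i : Fin n)

/-- The ladder graph `L_n` of order `2n`: the vertices are `(i, ε)`, with `ε` telling the two paths
apart. The labels `rail i ε` with `i` the last position are not edges of it. -/
def ladder (n : ℕ) : Graph (Fin n × Bool) (LadderEdge n) where
  vertexSet := Set.univ
  IsLink e x y := match e with
    | .rail i ε => ∃ j : Fin n, j.val = i.val + 1 ∧ s(x, y) = s((i, ε), (j, ε))
    | .spoke i => s(x, y) = s((i, true), (i, false))
  isLink_symm e _ := ⟨fun x y h => by
    rw [Sym2.eq_swap (a := y) (b := x)]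
    exact h⟩
  eq_or_eq_of_isLink_of_isLink := by
    rintro (⟨i, ε⟩ | i) x y v w h h'
    · obtain ⟨j, hj, h⟩ := h
      obtain ⟨j', hj', h'⟩ := h'
      obtain rfl : j = j' := Fin.ext (hj.trans hj'.symm)
      have := h.trans h'.symm
      grind
    · have := h.trans h'.symm
      grind
  left_mem_of_isLink _ _ _ _ := Set.mem_univ _

/-- The circular ladder graph `CL_n` of order `2n`: the two paths of the ladder are replaced by
cycles of length `n`, `finRotate n` being the map `i ↦ i + 1` modulo `n`. It is a simple graph for
`3 ≤ n`; the cycles consist of two parallel edges for `n = 2` and of a loop for `n = 1`. -/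
def circularLadder (n : ℕ) : Graph (Fin n × Bool) (LadderEdge n) where
  vertexSet := Set.univ
  IsLink e x y := match e with
    | .rail i ε => s(x, y) = s((i, ε), (finRotate n i, ε))
    | .spoke i => s(x, y) = s((i, true), (i, false))
  isLink_symm e _ := ⟨fun x y h => by
    rw [Sym2.eq_swap (a := y) (b := x)]
    exact h⟩
  eq_or_eq_of_isLink_of_isLink := by
    rintro (⟨i, ε⟩ | i) x y v w h h'
    all_goals
      have := h.trans h'.symm
      grind
  left_mem_of_isLink _ _ _ _ := Set.mem_univ _

/-- The sequence `s_n` with `s_0 = 0`, `s_1 = 1` and `s_n = 4 s_(n-1) - s_(n-2)`. -/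
def ladderSeq : ℕ → ℤ
  | 0 => 0
  | 1 => 1
  | n + 2 => 4 * ladderSeq (n + 1) - ladderSeq n

/-! Everything is deletion and contraction. A subgraph is a tree exactly when its edges connect all
vertices and number one fewer than the vertices (`Graph.isTreeGraph_iff`). Spanning trees thus
become edge sets, and `treeCount` counts these along a list of edges. The number of vertices is a
separate argument because a list of edges does not show isolated vertices.

A ladder is consumed column by column. Each of the two rails into the next column is deleted or
contracted, and in all four cases a shorter chain remains, preceded by an edge between its two front
vertices, possibly a loop (`treeCount_ladderChain_cons`). With a free far end, two counts determine
each other: for `k` further columns, $s_{k+1}-s_k$ if the front column is collapsed to a point and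
$s_k$ if its spoke is missing. Their sum is $s(L_{k+1})=s_{k+1}$ (`treeCount_ladderChain_none`).

Contracting a spoke of $CL_n$ to a vertex `v` makes the circle a chain through the other $n-1$
columns that starts and ends at `v`. Its recursion also produces chains whose front is partly or
wholly away from `v`. Closed forms for all these fronts are proved in one induction
(`treeCount_ladderChain_some`), and the front `v`, `v` gives $n\,s_n$. -/

/-! ### Trees as edge sets, deletion and contraction -/

section EdgeSets

open scoped Classical in
/-- The map that replaces `b` by `a` and fixes everything else. -/
noncomputable def identify {γ : Type*} (a b : γ) (x : γ) : γ := if x = b then a else x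

/-- `x` and `y` are joined by a walk along edges in `S`, where `d e` is the pair of ends of `e`. -/
def WalkJoined {β γ : Type*} (d : β → γ × γ) (S : Finset β) : γ → γ → Prop :=
  Relation.ReflTransGen fun x y => ∃ e ∈ S, s(x, y) = s((d e).1, (d e).2)

/-- Any two elements of `X` are joined by a walk along edges in `S`. -/
def ConnectedOn {β γ : Type*} (X : Finset γ) (d : β → γ × γ) (S : Finset β) : Prop :=
  ∀ x ∈ X, ∀ y ∈ X, WalkJoined d S x y

/-- The edges in `S` are those of a tree with vertex set `X`. -/
def IsTreeOn {β γ : Type*} (X : Finset γ) (d : β → γ × γ) (S : Finset β) : Prop :=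
  ConnectedOn X d S ∧ S.card + 1 = X.card

variable {β γ : Type*} {d : β → γ × γ} {S : Finset β} {X : Finset γ} {a b x y z : γ} {e : β}

@[simp]
lemma identify_self (a x : γ) : identify a a x = x := by
  unfold identify; split_ifs with h <;> simp [h]

@[simp]
lemma identify_right (a b : γ) : identify a b b = a := by simp [identify]

@[simp]
lemma identify_left (a b : γ) : identify a b a = a := by simp [identify]

lemma identify_of_ne (h : x ≠ b) : identify a b x = x := by simp [identify, h]

lemma WalkJoined.symm (h : WalkJoined d S x y) : WalkJoined d S y x :=
  by
  induction h with
  | refl => exact Relation.ReflTransGen.refl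
  | tail _ h ih =>
    obtain ⟨e, he, h⟩ := h
    exact Relation.ReflTransGen.head ⟨e, he, Sym2.eq_swap.trans h⟩ ih

lemma WalkJoined.trans (h : WalkJoined d S x y) (h' : WalkJoined d S y z) : WalkJoined d S x z :=
  Relation.ReflTransGen.trans h h'

lemma walkJoined_of_mem (he : e ∈ S) : WalkJoined d S (d e).1 (d e).2 :=
  Relation.ReflTransGen.single ⟨e, he, rfl⟩

/-- A relation that is an equivalence and holds for the ends of all edges holds for joined pairs. -/
lemma WalkJoined.rec_equivalence {r : γ → γ → Prop} (hr : Equivalence r)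
    (hS : ∀ e ∈ S, r (d e).1 (d e).2) (h : WalkJoined d S x y) : r x y := by
  induction h with
  | refl => exact hr.refl _
  | tail _ h ih =>
    obtain ⟨e, he, h⟩ := h
    refine hr.trans ih ?_
    rcases Sym2.eq_iff.1 h with ⟨rfl, rfl⟩ | ⟨rfl, rfl⟩
    · exact hS e he
    · exact hr.symm (hS e he)

lemma walkJoined_equivalence (d : β → γ × γ) (S : Finset β) : Equivalence (WalkJoined d S) :=
  ⟨fun _ => Relation.ReflTransGen.refl, WalkJoined.symm, WalkJoined.trans⟩

lemma walkJoined_insert_iff [DecidableEq β] (hd : d e = (a, b)) :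
    WalkJoined d (insert e S) x y ↔
      WalkJoined (Prod.map (identify a b) (identify a b) ∘ d) S
        (identify a b x) (identify a b y) := by
  set d' := Prod.map (identify a b) (identify a b) ∘ d with hd'
  -- Only `b` is moved, and `e` joins it to its image `a`.
  have key : ∀ x, WalkJoined d (insert e S) (identify a b x) x := fun x => by
    by_cases hx : x = b
    · subst hx
      simpa [hd] using walkJoined_of_mem (d := d) (Finset.mem_insert_self e S)
    · rw [identify_of_ne hx]
      exact (walkJoined_equivalence _ _).refl _
  constructor
  · refine WalkJoined.rec_equivalence
      (r := fun x y => WalkJoined d' S (identify a b x) (identify a b y))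
      ((walkJoined_equivalence d' S).comap (identify a b)) fun f hf => ?_
    rcases Finset.mem_insert.1 hf with rfl | hf
    · simpa [hd] using (walkJoined_equivalence d' S).refl a
    · exact walkJoined_of_mem hf
  · intro h
    refine (key x).symm.trans (WalkJoined.trans ?_ (key y))
    refine WalkJoined.rec_equivalence (walkJoined_equivalence _ _) (fun f hf => ?_) h
    exact (key _).trans ((walkJoined_of_mem (Finset.mem_insert_of_mem hf)).trans (key _).symm)

lemma identify_mem_erase [DecidableEq γ] (hab : a ≠ b) (ha : a ∈ X) (hx : x ∈ X) :
    identify a b x ∈ X.erase b := by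
  by_cases h : x = b
  · simp [h, hab, ha]
  · simp [identify_of_ne h, h, hx]

lemma connectedOn_insert_iff [DecidableEq β] [DecidableEq γ] (hd : d e = (a, b)) (hab : a ≠ b)
    (ha : a ∈ X) :
    ConnectedOn X d (insert e S) ↔
      ConnectedOn (X.erase b) (Prod.map (identify a b) (identify a b) ∘ d) S := by
  simp only [ConnectedOn, walkJoined_insert_iff hd]
  constructor
  · intro h x hx y hy
    rw [Finset.mem_erase] at hx hy
    simpa [identify_of_ne hx.1, identify_of_ne hy.1] using h x hx.2 y hy.2
  · exact fun h x hx y hy => h _ (identify_mem_erase hab ha hx) _ (identify_mem_erase hab ha hy)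

lemma connectedOn_insert_of_loop [DecidableEq β] (hd : d e = (a, a)) :
    ConnectedOn X d (insert e S) ↔ ConnectedOn X d S := by
  have h : Prod.map (identify a a) (identify a a) ∘ d = d := by
    ext <;> simp
  simp only [ConnectedOn, walkJoined_insert_iff hd, h, identify_self]

/-- Contracting the edges one at a time preserves connectedness, and each contraction removes at
most one vertex (none for a loop). -/
lemma ConnectedOn.card_le (hS : ∀ e ∈ S, (d e).1 ∈ X ∧ (d e).2 ∈ X) (h : ConnectedOn X d S) :
    X.card ≤ S.card + 1 := by
  classical
  induction S using Finset.induction_on generalizing d X with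
  | empty =>
    rw [Finset.card_empty, zero_add, Finset.card_le_one]
    exact fun x hx y hy => WalkJoined.rec_equivalence eq_equivalence (by simp) (h x hx y hy)
  | insert e S he ih =>
    have heX := hS e (Finset.mem_insert_self e S)
    have hS' : ∀ f ∈ S, (d f).1 ∈ X ∧ (d f).2 ∈ X :=
      fun f hf => hS f (Finset.mem_insert_of_mem hf)
    rw [Finset.card_insert_of_notMem he]
    rcases hd : d e with ⟨a, b⟩
    rw [hd] at heX
    by_cases hab : a = b
    · subst hab
      have := ih hS' ((connectedOn_insert_of_loop hd).1 h)
      omega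
    · have := ih (fun f hf => ⟨identify_mem_erase hab heX.1 (hS' f hf).1,
        identify_mem_erase hab heX.1 (hS' f hf).2⟩)
        ((connectedOn_insert_iff hd hab heX.1).1 h)
      rw [Finset.card_erase_of_mem heX.2] at this
      omega

/-- A connected graph all of whose edges are bridges has one vertex more than edges. -/
lemma ConnectedOn.card_eq_of_bridges [DecidableEq β] (hX : X.Nonempty)
    (hS : ∀ e ∈ S, (d e).1 ∈ X ∧ (d e).2 ∈ X) (h : ConnectedOn X d S)
    (hbr : ∀ e ∈ S, ¬ WalkJoined d (S.erase e) (d e).1 (d e).2) : S.card + 1 = X.card := by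
  classical
  induction S using Finset.induction_on generalizing d X with
  | empty =>
    have := h.card_le hS
    exact le_antisymm hX.card_pos this
  | insert e S he ih =>
    have heX := hS e (Finset.mem_insert_self e S)
    have heb := hbr e (Finset.mem_insert_self e S)
    have hS' : ∀ f ∈ S, (d f).1 ∈ X ∧ (d f).2 ∈ X :=
      fun f hf => hS f (Finset.mem_insert_of_mem hf)
    rw [Finset.card_insert_of_notMem he]
    rcases hd : d e with ⟨a, b⟩
    rw [hd] at heX heb
    have hab : a ≠ b := fun hab => heb (by
      simp only [hab]
      exact (walkJoined_equivalence _ _).refl b)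
    have := ih ⟨a, Finset.mem_erase.2 ⟨hab, heX.1⟩⟩
      (fun f hf => ⟨identify_mem_erase hab heX.1 (hS' f hf).1,
        identify_mem_erase hab heX.1 (hS' f hf).2⟩)
      ((connectedOn_insert_iff hd hab heX.1).1 h) (fun f hf hj => by
        have hfe : e ≠ f := fun h => he (h ▸ hf)
        -- A detour around `f` after contracting `e` lifts to a detour that may use `e`, so bridges
        -- stay bridges.
        have := (walkJoined_insert_iff hd).2 hj
        rw [← Finset.erase_insert_of_ne hfe] at this
        exact hbr f (Finset.mem_insert_of_mem hf) this)
    have hc : (X.erase b).card + 1 = X.card := Finset.card_erase_add_one heX.2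
    omega

/-- The number of spanning trees of a graph with `m` vertices and a list of edges given by their
ends, by deletion and contraction of the first edge. -/
noncomputable def treeCount {γ : Type*} : ℕ → List (γ × γ) → ℕ
  | m, [] => if m = 1 then 1 else 0
  | m, (a, b) :: l => treeCount m l + open scoped Classical in
      if a = b then 0 else treeCount (m - 1) (l.map (Prod.map (identify a b) (identify a b)))
  termination_by _ l => l.length

lemma isTreeOn_insert_iff [DecidableEq β] [DecidableEq γ] (hd : d e = (a, b)) (hab : a ≠ b)
    (ha : a ∈ X) (hb : b ∈ X) (he : e ∉ S) :
    IsTreeOn X d (insert e S) ↔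
      IsTreeOn (X.erase b) (Prod.map (identify a b) (identify a b) ∘ d) S := by
  rw [IsTreeOn, IsTreeOn, connectedOn_insert_iff hd hab ha, Finset.card_insert_of_notMem he,
    ← Finset.card_erase_add_one hb]
  simp

lemma not_isTreeOn_insert_of_loop [DecidableEq β] (hd : d e = (a, a)) (he : e ∉ S)
    (hS : ∀ e ∈ S, (d e).1 ∈ X ∧ (d e).2 ∈ X) : ¬ IsTreeOn X d (insert e S) := by
  rintro ⟨h, hc⟩
  have := ((connectedOn_insert_of_loop hd).1 h).card_le hS
  rw [Finset.card_insert_of_notMem he] at hc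
  omega

open scoped Classical in
-- Trees avoiding the first edge are counted by deletion. Those containing it correspond to the
-- trees of the contraction, and there are none if it is a loop.
lemma card_filter_isTreeOn (l : List β) (hl : l.Nodup)
    (hX : ∀ e ∈ l, (d e).1 ∈ X ∧ (d e).2 ∈ X) :
    (l.toFinset.powerset.filter (IsTreeOn X d)).card = treeCount X.card (l.map d) := by
  induction l generalizing d X with
  | nil =>
    rw [List.map_nil, treeCount]
    by_cases h : X.card = 1
    · have : IsTreeOn X d ∅ := by
        refine ⟨fun x hx y hy => ?_, by simp [h]⟩
        rw [Finset.card_le_one.1 h.le x hx y hy]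
        exact (walkJoined_equivalence _ _).refl y
      simp [h, Finset.filter_singleton, this]
    · have : ¬ IsTreeOn X d ∅ := fun ht => h (by simpa using ht.2.symm)
      simp [h, Finset.filter_singleton, this]
  | cons e l ih =>
    obtain ⟨he, hl⟩ := List.nodup_cons.1 hl
    have heX := hX e List.mem_cons_self
    have hX' : ∀ f ∈ l, (d f).1 ∈ X ∧ (d f).2 ∈ X := fun f hf => hX f (List.mem_cons_of_mem e hf)
    have he' : e ∉ l.toFinset := by simpa using he
    rcases hd : d e with ⟨a, b⟩
    rw [hd] at heX
    rw [List.toFinset_cons, Finset.powerset_insert, Finset.filter_union,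
      Finset.card_union_of_disjoint, List.map_cons, hd, treeCount, ih hl hX', add_right_inj,
      Finset.filter_image, Finset.card_image_of_injOn]
    · split_ifs with hab
      · subst hab
        rw [Finset.card_eq_zero, Finset.filter_eq_empty_iff]
        intro S hS
        rw [Finset.mem_powerset] at hS
        exact not_isTreeOn_insert_of_loop hd (fun h => he' (hS h))
          fun f hf => hX' f (List.mem_toFinset.1 (hS hf))
      · rw [List.map_map, ← Finset.card_erase_of_mem heX.2, ← ih hl
          (fun f hf => ⟨identify_mem_erase hab heX.1 (hX' f hf).1,
          identify_mem_erase hab heX.1 (hX' f hf).2⟩)]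
        congr 1
        refine Finset.filter_congr fun S hS => ?_
        rw [Finset.mem_powerset] at hS
        exact isTreeOn_insert_iff hd hab heX.1 heX.2 fun h => he' (hS h)
    · intro S hS T hT h
      simp only [Finset.coe_filter, Finset.mem_powerset, Set.mem_ofPred_eq] at hS hT
      have := congrArg (fun U => U.erase e) h
      simpa [Finset.erase_insert (fun h => he' (hS.1 h)),
        Finset.erase_insert (fun h => he' (hT.1 h))] using this
    · rw [Finset.disjoint_left]
      intro S hS hS'
      simp only [Finset.mem_filter, Finset.mem_powerset, Finset.mem_image] at hS hS'
      obtain ⟨⟨T, -, rfl⟩, -⟩ := hS'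
      exact he' (hS.1 (Finset.mem_insert_self e T))

end EdgeSets

/-! ### From multigraphs to edge lists -/

section Multigraphs

/-- WalkJoined vertices are the ends of a path without repeated vertices. -/
lemma Relation.ReflTransGen.exists_injOn_path {α : Type*} {r : α → α → Prop}
    (hr : ∀ x y, r x y → r y x)    {x y : α} (h : Relation.ReflTransGen r x y) :
    ∃ (k : ℕ) (v : ℕ → α), v 0 = x ∧ v k = y ∧ Set.InjOn v {i | i ≤ k} ∧
      ∀ i < k, r (v i) (v (i + 1)) := by
  classical
  have hreach : (SimpleGraph.fromRel r).Reachable x y := by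
    induction h with
    | refl => exact SimpleGraph.Reachable.refl _
    | @tail b c _ hbc ih =>
      by_cases h : b = c
      · exact h ▸ ih
      · exact ih.trans (SimpleGraph.Adj.reachable ((SimpleGraph.fromRel_adj r b c).2
          ⟨h, Or.inl hbc⟩))
  obtain ⟨p, hp⟩ := hreach.exists_isPath
  refine ⟨p.length, p.getVert, p.getVert_zero, p.getVert_length, hp.getVert_injOn, fun i hi => ?_⟩
  have := p.adj_getVert_succ hi
  rw [SimpleGraph.fromRel_adj] at this
  exact this.2.elim id fun h => hr _ _ h

variable {α β : Type*} {G : Graph α β} {X : Finset α} {S : Finset β} {d : β → α × α}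

lemma Graph.HasCycle.exists_walkJoined [DecidableEq β]
    (hG : ∀ e x y, G.IsLink e x y ↔ e ∈ S ∧ s(x, y) = s((d e).1, (d e).2)) (h : G.HasCycle) :
    ∃ e ∈ S, WalkJoined d (S.erase e) (d e).1 (d e).2 := by
  obtain ⟨k, v, e, -, he, hl⟩ := h
  have h0 := (hG _ _ _).1 (hl 0)
  refine ⟨e 0, h0.1, ?_⟩
  -- Going round the cycle from the far end of `e 0` without using `e 0`; at `j = k` the index wraps
  -- to `0`.
  have key : ∀ j : ℕ, j ≤ k → WalkJoined d (S.erase (e 0)) (v (0 + 1))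
      (v (Fin.ofNat (k + 1) (j + 1))) := by
    intro j
    induction j with
    | zero =>
      intro _
      rw [show Fin.ofNat (k + 1) (0 + 1) = 0 + 1 from Fin.ext (by simp)]
      exact (walkJoined_equivalence _ _).refl _
    | succ j ih =>
      intro hj
      refine (ih (by omega)).trans ?_
      have hlj := (hG _ _ _).1 (hl (Fin.ofNat (k + 1) (j + 1)))
      refine Relation.ReflTransGen.single ⟨e (Fin.ofNat (k + 1) (j + 1)),
        Finset.mem_erase.2 ⟨?_, hlj.1⟩, ?_⟩
      · intro h
        have := congrArg Fin.val (he h)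
        rw [Fin.val_ofNat, Nat.mod_eq_of_lt (by omega)] at this
        simp at this
      · have hsucc : Fin.ofNat (k + 1) (j + 1) + 1 = Fin.ofNat (k + 1) (j + 1 + 1) :=
          Fin.ext (by simp [Fin.val_add])
        rw [← hsucc]
        exact hlj.2
  have hk := key k le_rfl
  rw [show Fin.ofNat (k + 1) (k + 1) = 0 from Fin.ext (by simp)] at hk
  rcases Sym2.eq_iff.1 h0.2 with ⟨h1, h2⟩ | ⟨h1, h2⟩
  · rw [← h1, ← h2]
    exact hk.symm
  · rw [← h1, ← h2]
    exact hk

lemma Graph.hasCycle_of_walkJoined [DecidableEq β]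
    (hG : ∀ e x y, G.IsLink e x y ↔ e ∈ S ∧ s(x, y) = s((d e).1, (d e).2)) {e : β} (he : e ∈ S)
    (h : WalkJoined d (S.erase e) (d e).1 (d e).2) : G.HasCycle := by
  obtain ⟨k, v, h0, hk, hinj, hl⟩ := Relation.ReflTransGen.exists_injOn_path
    (fun _ _ ⟨e, he, h⟩ => ⟨e, he, Sym2.eq_swap.trans h⟩) h
  have : Nonempty β := ⟨e⟩
  choose! f hf hfl using hl
  -- The path is closed up by `e`; `k = 0` is the case of a loop. Path edges are distinct because
  -- the vertices do not repeat, so the pair of ends determines the position.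
  refine ⟨k, fun i => v i, fun i => if i.val < k then f i else e, ?_, ?_, ?_⟩
  · intro i j hij
    exact Fin.ext (hinj (Nat.lt_succ_iff.1 i.2) (Nat.lt_succ_iff.1 j.2) hij)
  · intro i j hij
    have hi := i.2
    have hj := j.2
    dsimp only at hij
    split_ifs at hij with h1 h2 h2
    · have hs := (hfl i h1).trans ((congrArg (fun e => s((d e).1, (d e).2)) hij).trans
        (hfl j h2).symm)
      rcases Sym2.eq_iff.1 hs with ⟨h3, -⟩ | ⟨h3, h4⟩
      · exact Fin.ext (hinj h1.le h2.le h3)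
      · have h5 : i.val = j + 1 := hinj h1.le h2 h3
        have h6 : i.val + 1 = j := hinj h1 h2.le h4
        omega
    · exact absurd hij (Finset.ne_of_mem_erase (hf i h1))
    · exact absurd hij.symm (Finset.ne_of_mem_erase (hf j h2))
    · exact Fin.ext (by omega)
  · intro i
    rw [hG]
    by_cases hi : i.val < k
    · have hi1 : ((i + 1 : Fin (k + 1)) : ℕ) = i + 1 := Fin.val_add_one_of_lt (by
        rw [Fin.lt_def]; simpa using hi)
      simp only [hi, if_true, hi1]
      exact ⟨Finset.mem_of_mem_erase (hf i hi), hfl i hi⟩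
    · have hi' : i = Fin.last k := Fin.ext (by have := i.2; simp; omega)
      subst hi'
      simp [he, h0, hk, Sym2.eq_swap]

lemma Graph.isTreeGraph_iff (hV : G.vertexSet = X) (hX : X.Nonempty)
    (hG : ∀ e x y, G.IsLink e x y ↔ e ∈ S ∧ s(x, y) = s((d e).1, (d e).2)) :
    G.IsTreeGraph ↔ IsTreeOn X d S := by
  classical
  have hS : ∀ e ∈ S, (d e).1 ∈ X ∧ (d e).2 ∈ X := fun e he => by
    have := (hG e _ _).2 ⟨he, rfl⟩
    have h1 := this.left_mem
    have h2 := this.right_mem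
    rw [hV] at h1 h2
    exact ⟨h1, h2⟩
  have hadj : G.Adj = fun x y => ∃ e ∈ S, s(x, y) = s((d e).1, (d e).2) := by
    ext x y
    simp [Graph.Adj, hG]
  have hconn : G.IsConn ↔ ConnectedOn X d S := by
    simp [Graph.IsConn, ConnectedOn, WalkJoined, hV, hadj, hX]
  rw [Graph.IsTreeGraph, IsTreeOn, hconn]
  refine and_congr_right fun hc => ⟨fun h => ?_, fun h hcyc => ?_⟩
  · exact hc.card_eq_of_bridges hX hS fun e he hj => h (Graph.hasCycle_of_walkJoined hG he hj)
  -- Removing an edge of a cycle would leave a connected graph with too few edges.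
  · obtain ⟨e, he, hj⟩ := hcyc.exists_walkJoined hG
    have : ConnectedOn X d (S.erase e) := fun x hx y hy =>
      (hc x hx y hy).rec_equivalence (walkJoined_equivalence _ _) fun f hf => by
        by_cases hfe : f = e
        · exact hfe ▸ hj
        · exact walkJoined_of_mem (Finset.mem_erase.2 ⟨hfe, hf⟩)
    have := this.card_le fun f hf => hS f (Finset.mem_of_mem_erase hf)
    have := Finset.card_erase_add_one he
    omega

/-- The number of spanning trees of a multigraph with vertex set `X` and edges listed by `l`, the
edge `e` having the ends `(d e).1` and `(d e).2`. -/
theorem Graph.numSpanningTrees_eq_treeCount (hV : G.vertexSet = X) (hX : X.Nonempty)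
    (l : List β) (hl : l.Nodup)
    (hG : ∀ e x y, G.IsLink e x y ↔ e ∈ l ∧ s(x, y) = s((d e).1, (d e).2)) :
    G.numSpanningTrees = treeCount X.card (l.map d) := by
  classical
  have hlX : ∀ e ∈ l, (d e).1 ∈ X ∧ (d e).2 ∈ X := fun e he => by
    have := (hG e _ _).2 ⟨he, rfl⟩
    have h1 := this.left_mem
    have h2 := this.right_mem
    rw [hV] at h1 h2
    exact ⟨h1, h2⟩
  have hE : ∀ e, e ∈ G.edgeSet ↔ e ∈ l := fun e => by
    rw [G.edge_mem_iff_exists_isLink]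
    exact ⟨fun ⟨x, y, h⟩ => ((hG e x y).1 h).1, fun h => ⟨_, _, (hG e _ _).2 ⟨h, rfl⟩⟩⟩
  have htree : ∀ S : Finset β, S ⊆ l.toFinset →
      ((G.restrict S).IsTreeGraph ↔ IsTreeOn X d S) := fun S hS =>
    Graph.isTreeGraph_iff (by simpa using hV) hX fun e x y => by
      simp only [Graph.restrict_isLink, hG, Finset.mem_coe]
      have : e ∈ S → e ∈ l := fun h => List.mem_toFinset.1 (hS h)
      tauto
  rw [← card_filter_isTreeOn l hl hlX, Graph.numSpanningTrees, ← Set.ncard_coe_finset]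
  -- A spanning subgraph is the restriction of `G` to its own edge set.
  have himg : G.spanningTrees = (fun S : Finset β => G.restrict (S : Set β)) ''
      (l.toFinset.powerset.filter (IsTreeOn X d) : Finset (Finset β)) := by
    ext T
    simp only [Graph.spanningTrees, Set.mem_ofPred_eq, Set.mem_image, Finset.coe_filter,
      Finset.mem_powerset]
    constructor
    · rintro ⟨hT, htr⟩
      have hTl : ∀ e ∈ T.edgeSet, e ∈ l := fun e he => (hE e).1 (hT.le.edgeSet_mono he)
      have hS : ((l.toFinset.filter (· ∈ T.edgeSet) : Finset β) : Set β) = T.edgeSet := by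
        ext e
        simpa using hTl e
      have hres : G.restrict T.edgeSet = T :=
        (Graph.Compatible.of_le_le Graph.restrict_le hT.le).ext
          (by simpa using hT.vertexSet_eq.symm)
          (by simpa using hT.le.edgeSet_mono)
      refine ⟨l.toFinset.filter (· ∈ T.edgeSet), ⟨Finset.filter_subset _ _, ?_⟩, ?_⟩
      · rw [← htree _ (Finset.filter_subset _ _), hS, hres]
        exact htr
      · rw [hS, hres]
    · rintro ⟨S, ⟨hS, htr⟩, rfl⟩
      exact ⟨⟨Graph.restrict_le, by simp⟩, (htree S hS).2 htr⟩
  rw [himg, Set.InjOn.ncard_image]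
  intro S hS T hT h
  simp only [Finset.coe_filter, Finset.mem_powerset, Set.mem_ofPred_eq] at hS hT
  have := congrArg Graph.edgeSet h
  ext e
  have he := Set.ext_iff.1 this e
  have h1 : e ∈ S → e ∈ l := fun h => List.mem_toFinset.1 (hS.1 h)
  have h2 : e ∈ T → e ∈ l := fun h => List.mem_toFinset.1 (hT.1 h)
  simp only [Graph.edgeSet_restrict, Set.mem_inter_iff, hE, Finset.mem_coe] at he
  tauto

end Multigraphs

/-! ### Recursions for chains of columns -/

section Chains

variable {γ : Type*} {a b p q v x y : γ} {l c : List (γ × γ)} {t : Option γ} {m : ℕ}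

lemma treeCount_nil (m : ℕ) : treeCount m ([] : List (γ × γ)) = if m = 1 then 1 else 0 := by
  rw [treeCount]

lemma treeCount_cons_self (m : ℕ) (a : γ) (l : List (γ × γ)) :
    treeCount m ((a, a) :: l) = treeCount m l := by
  rw [treeCount]; simp

lemma treeCount_cons_of_ne (m : ℕ) (h : a ≠ b) (l : List (γ × γ)) :
    treeCount m ((a, b) :: l) = treeCount m l +
      treeCount (m - 1) (l.map (Prod.map (identify a b) (identify a b))) := by
  rw [treeCount]; simp [h]

/-- Too few vertices are met by edges for the graph to be connected. -/
lemma treeCount_eq_zero (Y : Finset γ) (hY : ∀ r ∈ l, r.1 ∈ Y ∧ r.2 ∈ Y) (h : Y.card < m)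
    (hm : 2 ≤ m) : treeCount m l = 0 := by
  classical
  obtain ⟨n, hn⟩ : ∃ n, l.length = n := ⟨_, rfl⟩
  induction n generalizing l m Y with
  | zero =>
    rw [List.length_eq_zero_iff.1 hn, treeCount_nil, if_neg (by omega)]
  | succ n ih =>
    obtain ⟨⟨a, b⟩, l, rfl⟩ := List.exists_cons_of_length_eq_add_one hn
    rw [List.length_cons, add_left_inj] at hn
    obtain ⟨⟨ha, hb⟩, hl⟩ := List.forall_mem_cons.1 hY
    by_cases hab : a = b
    · subst hab
      rw [treeCount_cons_self, ih Y hl h hm hn]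
    -- Two distinct ends force `3 ≤ m`, so the bound `2 ≤ m` survives the contraction.
    · have h2 : 2 ≤ Y.card := Finset.one_lt_card.2 ⟨a, ha, b, hb, hab⟩
      have hc : (Y.erase b).card + 1 = Y.card := Finset.card_erase_add_one hb
      rw [treeCount_cons_of_ne m hab, ih Y hl h hm hn,
        ih (Y.erase b) _ (by omega) (by omega) (by simpa using hn)]
      intro r hr
      obtain ⟨u, hu, rfl⟩ := List.mem_map.1 hr
      exact ⟨identify_mem_erase hab ha (hl u hu).1, identify_mem_erase hab ha (hl u hu).2⟩

/-- The edges of a ladder that continues from the column `x`, `y` through the columns in `c`. The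
vertices in the last column are joined to the vertex `t` if there is one. -/
def ladderChain {γ : Type*} (t : Option γ) : γ → γ → List (γ × γ) → List (γ × γ)
  | x, y, [] => t.toList.flatMap fun v => [(x, v), (y, v)]
  | x, y, (p, q) :: c => (x, p) :: (y, q) :: (p, q) :: ladderChain t p q c

/-- The vertices of a list of columns. -/
def columnVertices {γ : Type*} (c : List (γ × γ)) : List γ := c.flatMap fun r => [r.1, r.2]

@[simp]
lemma columnVertices_nil : columnVertices ([] : List (γ × γ)) = [] := rfl

@[simp]
lemma columnVertices_cons (r : γ × γ) (c : List (γ × γ)) :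
    columnVertices (r :: c) = r.1 :: r.2 :: columnVertices c := rfl

lemma length_columnVertices (c : List (γ × γ)) : (columnVertices c).length = 2 * c.length := by
  induction c with
  | nil => rfl
  | cons r c ih => simp [ih]; omega

lemma map_ladderChain (σ : γ → γ) (t : Option γ) (x y : γ) (c : List (γ × γ)) :
    (ladderChain t x y c).map (Prod.map σ σ) =
      ladderChain (t.map σ) (σ x) (σ y) (c.map (Prod.map σ σ)) := by
  induction c generalizing x y with
  | nil => cases t <;> simp [ladderChain]
  | cons r c ih => simp [ladderChain, ih, Prod.map]

lemma map_identify_of_notMem (h : b ∉ columnVertices c) :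
    c.map (Prod.map (identify a b) (identify a b)) = c := by
  induction c with
  | nil => rfl
  | cons r c ih =>
    simp only [columnVertices_cons, List.mem_cons, not_or] at h
    simp [ih h.2.2, identify_of_ne (Ne.symm h.1), identify_of_ne (Ne.symm h.2.1), Prod.map]

lemma map_identify_ladderChain (h : b ∉ columnVertices c) :
    (ladderChain t x y c).map (Prod.map (identify a b) (identify a b)) =
      ladderChain (t.map (identify a b)) (identify a b x) (identify a b y) c := by
  rw [map_ladderChain, map_identify_of_notMem h]

lemma mem_ladderChain {r : γ × γ} (h : r ∈ ladderChain t x y c) :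
    (r.1 ∈ t ∨ r.1 = x ∨ r.1 = y ∨ r.1 ∈ columnVertices c) ∧
      (r.2 ∈ t ∨ r.2 = x ∨ r.2 = y ∨ r.2 ∈ columnVertices c) := by
  induction c generalizing x y with
  | nil =>
    cases t with
    | none => simp [ladderChain] at h
    | some v =>
      simp only [ladderChain, Option.toList_some, List.flatMap_singleton, List.mem_cons,
        List.not_mem_nil, or_false] at h
      rcases h with rfl | rfl <;> simp
  | cons s c ih =>
    simp only [ladderChain, List.mem_cons] at h
    simp only [columnVertices_cons, List.mem_cons]
    rcases h with rfl | rfl | rfl | h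
    · simp
    · simp
    · simp
    · have := ih h
      tauto

/-- Disposes of the cases where deleted rails leave a front vertex isolated: `m` still counts that
vertex, but no edge meets it. -/
lemma treeCount_spoke_ladderChain_eq_zero (Y : Finset γ) (hx : x ∈ Y) (hy : y ∈ Y)
    (ht : ∀ v ∈ t, v ∈ Y) (hm : Y.card + 2 * c.length < m) :
    treeCount m ((x, y) :: ladderChain t x y c) = 0 := by
  classical
  refine treeCount_eq_zero (Y ∪ (columnVertices c).toFinset) (fun r hr => ?_) ?_ ?_
  · rcases List.mem_cons.1 hr with rfl | hr
    · simp [hx, hy]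
    · have := mem_ladderChain hr
      simp only [Finset.mem_union, List.mem_toFinset]
      constructor
      · rcases this.1 with h | h | h | h
        · exact Or.inl (ht _ h)
        · exact Or.inl (h ▸ hx)
        · exact Or.inl (h ▸ hy)
        · exact Or.inr h
      · rcases this.2 with h | h | h | h
        · exact Or.inl (ht _ h)
        · exact Or.inl (h ▸ hx)
        · exact Or.inl (h ▸ hy)
        · exact Or.inr h
  · have h1 := Finset.card_union_le Y (columnVertices c).toFinset
    have h2 := List.toFinset_card_le (columnVertices c)
    rw [length_columnVertices] at h2
    omega
  · have := Finset.card_pos.2 ⟨x, hx⟩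
    omega

/-- Deletion and contraction of the two rails that lead to the next column. -/
lemma treeCount_ladderChain_cons (hpq : p ≠ q) (hp : p ∉ columnVertices c)
    (hq : q ∉ columnVertices c) (hxp : x ≠ p) (hxq : x ≠ q) (hyp : y ≠ p) (hyq : y ≠ q)
    (htp : p ∉ t) (htq : q ∉ t) :
    treeCount m (ladderChain t x y ((p, q) :: c)) =
      treeCount m ((p, q) :: ladderChain t p q c) +
      treeCount (m - 1) ((p, y) :: ladderChain t p y c) +
      treeCount (m - 1) ((x, q) :: ladderChain t x q c) +
      treeCount (m - 2) ((x, y) :: ladderChain t x y c) := by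
  have hmap : ∀ a b, b ∉ t → t.map (identify a b) = t := fun a b hb => by
    cases t with
    | none => rfl
    | some v =>
      have : v ≠ b := fun h => hb (by simp [h])
      simp [identify_of_ne this]
  simp only [ladderChain, treeCount_cons_of_ne _ hxp, treeCount_cons_of_ne _ hyq, List.map_cons,
    Prod.map_apply, identify_right, identify_of_ne hpq, identify_of_ne hpq.symm,
    identify_of_ne hyp, identify_of_ne hxq, map_identify_ladderChain hp,
    map_identify_ladderChain hq, hmap _ _ htp, hmap _ _ htq, Nat.sub_sub,
    Nat.reduceAdd]
  omega

/-- Deletion and contraction of a spoke. -/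
lemma treeCount_spoke_ladderChain (h : x ≠ y) (hy : y ∉ columnVertices c) :
    treeCount m ((x, y) :: ladderChain t x y c) = treeCount m (ladderChain t x y c) +
      treeCount (m - 1) (ladderChain (t.map (identify x y)) x x c) := by
  rw [treeCount_cons_of_ne m h, map_identify_ladderChain hy, identify_left, identify_right]

/-- Let $A_k$ and $B_k$ be the counts for a collapsed front and for distinct front vertices without
a spoke. Dropping the terms with an isolated vertex gives $A_{k+1}=2(A_k+B_k)+A_k$ and
$B_{k+1}=A_k+B_k$. -/
lemma treeCount_ladderChain_none (hc : (columnVertices c).Nodup) (hx : x ∉ columnVertices c) :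
    (treeCount (2 * c.length + 1) (ladderChain none x x c) : ℤ) =
        ladderSeq (c.length + 1) - ladderSeq c.length ∧
      ∀ y, y ∉ columnVertices c → x ≠ y →
        (treeCount (2 * c.length + 2) (ladderChain none x y c) : ℤ) = ladderSeq c.length := by
  classical
  induction c generalizing x with
  | nil => simp [ladderChain, treeCount_nil, ladderSeq]
  | cons r c ih =>
    obtain ⟨p, q⟩ := r
    simp only [columnVertices_cons, List.nodup_cons, List.mem_cons, not_or] at hc hx
    obtain ⟨⟨hpq, hp⟩, hq, hc⟩ := hc
    obtain ⟨hxp, hxq, hx⟩ := hx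
    have zero : ∀ (m : ℕ) (x y : γ), 2 + 2 * c.length < m →
        treeCount m ((x, y) :: ladderChain none x y c) = 0 := fun m x y hm =>
      treeCount_spoke_ladderChain_eq_zero {x, y} (by simp) (by simp) (by simp)
        (lt_of_le_of_lt (Nat.add_le_add_right Finset.card_le_two _) hm)
    have spoke : ∀ x y, x ∉ columnVertices c → y ∉ columnVertices c → x ≠ y →
        (treeCount (2 * c.length + 2) ((x, y) :: ladderChain none x y c) : ℤ) =
          ladderSeq (c.length + 1) := fun x y hx hy hxy => by
      rw [treeCount_spoke_ladderChain hxy hy]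
      have h1 := (ih hc hx).1
      have h2 := (ih hc hx).2 y hy hxy
      push_cast
      simp only [Option.map_none]
      rw [h2, h1]
      ring
    constructor
    · rw [treeCount_ladderChain_cons hpq hp hq hxp hxq hxp hxq (by simp) (by simp),
        zero _ _ _ (by simp; omega), treeCount_cons_self]
      have e1 : 2 * ((p, q) :: c).length + 1 - 1 = 2 * c.length + 2 := by simp; omega
      have e2 : 2 * ((p, q) :: c).length + 1 - 2 = 2 * c.length + 1 := by simp; omega
      rw [e1, e2]
      push_cast
      rw [spoke p x hp hx (Ne.symm hxp), spoke x q hx hq hxq, (ih hc hx).1, List.length_cons,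
        ladderSeq]
      ring
    · intro y hy hxy
      simp only [columnVertices_cons, List.mem_cons, not_or] at hy
      obtain ⟨hyp, hyq, hy⟩ := hy
      rw [treeCount_ladderChain_cons hpq hp hq hxp hxq hyp hyq (by simp) (by simp),
        zero _ _ _ (by simp; omega), zero _ _ _ (by simp; omega), zero _ _ _ (by simp; omega)]
      have e2 : 2 * ((p, q) :: c).length + 2 - 2 = 2 * c.length + 2 := by simp; omega
      rw [e2]
      push_cast
      rw [spoke x y hx hy hxy, List.length_cons]
      ring

/-- Let $P,Q,R,T$ count the fronts `v v`, `x x`, `v x` (or `x v`) and `x y`. A front spoke turns $T$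
into $T+Q$ and $R$ into $R+P$, so one more column gives $P'=(T+Q)+2(R+P)+P$, $Q'=2(T+Q)+Q$,
$R'=(T+Q)+(R+P)$ and $T'=T+Q$. The formula for $R$ is doubled to avoid halves. -/
lemma treeCount_ladderChain_some (hc : (columnVertices c).Nodup) (hv : v ∉ columnVertices c) :
    ((treeCount (2 * c.length + 1) (ladderChain (some v) v v c) : ℤ) =
        (c.length + 1) * ladderSeq (c.length + 1)) ∧
    (∀ x, x ∉ columnVertices c → x ≠ v →
      (treeCount (2 * c.length + 2) (ladderChain (some v) x x c) : ℤ) =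
          2 * ladderSeq (c.length + 1) ∧
      2 * (treeCount (2 * c.length + 2) (ladderChain (some v) v x c) : ℤ) =
          (c.length + 2) * ladderSeq (c.length + 1) - (c.length + 1) * ladderSeq c.length ∧
      2 * (treeCount (2 * c.length + 2) (ladderChain (some v) x v c) : ℤ) =
          (c.length + 2) * ladderSeq (c.length + 1) - (c.length + 1) * ladderSeq c.length ∧
      ∀ y, y ∉ columnVertices c → x ≠ y → y ≠ v →
        (treeCount (2 * c.length + 3) (ladderChain (some v) x y c) : ℤ) =
          ladderSeq (c.length + 1) - ladderSeq c.length) := by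
  classical
  induction c generalizing v with
  | nil =>
    simp only [ladderChain, Option.toList_some, List.flatMap_singleton]
    refine ⟨by simp [treeCount_cons_self, treeCount_nil, ladderSeq], fun x _ hx => ⟨?_, ?_, ?_,
      fun y _ hxy hy => ?_⟩⟩
    · simp [treeCount_cons_self, treeCount_cons_of_ne _ hx, treeCount_nil, ladderSeq]
    · simp [treeCount_cons_self, treeCount_cons_of_ne _ hx, treeCount_nil, ladderSeq]
    · simp [treeCount_cons_self, treeCount_cons_of_ne _ hx, treeCount_nil, ladderSeq]
    · simp [treeCount_cons_of_ne _ hx, treeCount_cons_of_ne _ hy,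
        treeCount_cons_of_ne _ (Ne.symm hxy), identify_of_ne hy, treeCount_nil, ladderSeq]
  | cons r c ih =>
    obtain ⟨p, q⟩ := r
    simp only [columnVertices_cons, List.nodup_cons, List.mem_cons, not_or] at hc hv
    obtain ⟨⟨hpq, hp⟩, hq, hc⟩ := hc
    obtain ⟨hvp, hvq, hv⟩ := hv
    have zero : ∀ (m : ℕ) (x y : γ), 3 + 2 * c.length < m →
        treeCount m ((x, y) :: ladderChain (some v) x y c) = 0 := fun m x y hm =>
      treeCount_spoke_ladderChain_eq_zero {v, x, y} (by simp) (by simp) (by simp)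
        (lt_of_le_of_lt (Nat.add_le_add_right Finset.card_le_three _) hm)
    have zero_left : ∀ (m : ℕ) (y : γ), 2 + 2 * c.length < m →
        treeCount m ((v, y) :: ladderChain (some v) v y c) = 0 := fun m y hm =>
      treeCount_spoke_ladderChain_eq_zero {v, y} (by simp) (by simp) (by simp)
        (lt_of_le_of_lt (Nat.add_le_add_right Finset.card_le_two _) hm)
    have zero_right : ∀ (m : ℕ) (x : γ), 2 + 2 * c.length < m →
        treeCount m ((x, v) :: ladderChain (some v) x v c) = 0 := fun m x hm =>
      treeCount_spoke_ladderChain_eq_zero {x, v} (by simp) (by simp) (by simp)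
        (lt_of_le_of_lt (Nat.add_le_add_right Finset.card_le_two _) hm)
    have spoke : ∀ x y, x ∉ columnVertices c → y ∉ columnVertices c → x ≠ y → x ≠ v → y ≠ v →
        (treeCount (2 * c.length + 3) ((x, y) :: ladderChain (some v) x y c) : ℤ) =
          3 * ladderSeq (c.length + 1) - ladderSeq c.length := fun x y hx hy hxy hxv hyv => by
      rw [treeCount_spoke_ladderChain hxy hy]
      obtain ⟨h1, -, -, h2⟩ := (ih hc hv).2 x hx hxv
      have h3 := h2 y hy hxy hyv
      push_cast
      simp only [Option.map_some, identify_of_ne (Ne.symm hyv)]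
      rw [h3, h1]
      ring
    have spoke_left : ∀ y, y ∉ columnVertices c → y ≠ v →
        2 * (treeCount (2 * c.length + 2) ((v, y) :: ladderChain (some v) v y c) : ℤ) =
          (3 * c.length + 4) * ladderSeq (c.length + 1) - (c.length + 1) * ladderSeq c.length :=
      fun y hy hyv => by
        rw [treeCount_spoke_ladderChain (Ne.symm hyv) hy]
        have h1 := (ih hc hv).1
        have h2 := ((ih hc hv).2 y hy hyv).2.1
        push_cast
        simp only [Option.map_some, identify_left]
        rw [mul_add, h2, h1]
        ring
    have spoke_right : ∀ x, x ∉ columnVertices c → x ≠ v →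
        2 * (treeCount (2 * c.length + 2) ((x, v) :: ladderChain (some v) x v c) : ℤ) =
          (3 * c.length + 4) * ladderSeq (c.length + 1) - (c.length + 1) * ladderSeq c.length :=
      fun x hx hxv => by
        rw [treeCount_spoke_ladderChain hxv hv]
        -- Contracting `(x, v)` renames `v` to `x` at the far end too, so the induction hypothesis
        -- is needed with `x` as the closing vertex.
        have h1 := (ih hc hx).1
        have h2 := ((ih hc hv).2 x hx hxv).2.2.1
        push_cast
        simp only [Option.map_some, identify_right]
        rw [mul_add, h2, h1]
        ring
    have hpv : p ∉ some v := by simpa using hvp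
    have hqv : q ∉ some v := by simpa using hvq
    have e1 : 2 * ((p, q) :: c).length + 1 = 2 * c.length + 3 := by simp; omega
    have e2 : 2 * ((p, q) :: c).length + 2 = 2 * c.length + 4 := by simp; omega
    have e3 : 2 * ((p, q) :: c).length + 3 = 2 * c.length + 5 := by simp; omega
    have e4 : ladderSeq (c.length + 1 + 1) = 4 * ladderSeq (c.length + 1) - ladderSeq c.length :=
      rfl
    rw [e1, e2, e3, List.length_cons]
    refine ⟨?_, fun x hx hxv => ?_⟩
    · rw [treeCount_ladderChain_cons hpq hp hq hvp hvq hvp hvq hpv hqv, treeCount_cons_self]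
      have h1 := spoke p q hp hq hpq (Ne.symm hvp) (Ne.symm hvq)
      have h2 := spoke_right p hp (Ne.symm hvp)
      have h3 := spoke_left q hq (Ne.symm hvq)
      have h4 := (ih hc hv).1
      simp only [Nat.reduceSubDiff]
      push_cast
      rw [e4]
      linarith
    simp only [columnVertices_cons, List.mem_cons, not_or] at hx
    obtain ⟨hxp, hxq, hx⟩ := hx
    refine ⟨?_, ?_, ?_, fun y hy hxy hyv => ?_⟩
    · rw [treeCount_ladderChain_cons hpq hp hq hxp hxq hxp hxq hpv hqv, treeCount_cons_self,
        zero _ p q (by omega)]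
      have h1 := spoke p x hp hx (Ne.symm hxp) (Ne.symm hvp) hxv
      have h2 := spoke x q hx hq hxq hxv (Ne.symm hvq)
      have h3 := ((ih hc hv).2 x hx hxv).1
      simp only [Nat.reduceSubDiff]
      push_cast
      rw [e4]
      linarith
    · rw [treeCount_ladderChain_cons hpq hp hq hvp hvq hxp hxq hpv hqv,
        zero _ p q (by omega), zero_left _ q (by omega)]
      have h1 := spoke p x hp hx (Ne.symm hxp) (Ne.symm hvp) hxv
      have h2 := spoke_left x hx hxv
      simp only [Nat.reduceSubDiff]
      push_cast
      rw [e4]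
      linarith
    · rw [treeCount_ladderChain_cons hpq hp hq hxp hxq hvp hvq hpv hqv,
        zero _ p q (by omega), zero_right _ p (by omega)]
      have h1 := spoke x q hx hq hxq hxv (Ne.symm hvq)
      have h2 := spoke_right x hx hxv
      simp only [Nat.reduceSubDiff]
      push_cast
      rw [e4]
      linarith
    · simp only [columnVertices_cons, List.mem_cons, not_or] at hy
      obtain ⟨hyp, hyq, hy⟩ := hy
      rw [treeCount_ladderChain_cons hpq hp hq hxp hxq hyp hyq hpv hqv,
        zero _ p q (by omega), zero _ p y (by omega), zero _ x q (by omega)]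
      have h1 := spoke x y hx hy hxy hxv hyv
      simp only [Nat.reduceSubDiff]
      push_cast
      rw [e4]
      linarith

end Chains

/-! ### Cyclic enumeration of columns and edges -/

section CircularColumns

variable {m : ℕ} {γ : Type*}

/-- The position `k` steps after `i`, cyclically. -/
def stepsFrom {m : ℕ} (i : Fin (m + 1)) (k : ℕ) : Fin (m + 1) := i + Fin.ofNat (m + 1) k

lemma stepsFrom_zero (i : Fin (m + 1)) : stepsFrom i 0 = i := by simp [stepsFrom]

lemma stepsFrom_succ (i : Fin (m + 1)) (k : ℕ) :
    stepsFrom i (k + 1) = finRotate (m + 1) (stepsFrom i k) := by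
  rw [finRotate_apply, stepsFrom, stepsFrom, add_assoc]
  congr 1
  exact Fin.ext (by simp [Fin.val_add])

lemma stepsFrom_self (i : Fin (m + 1)) : stepsFrom i (m + 1) = i := by
  have : Fin.ofNat (m + 1) (m + 1) = 0 := Fin.ext (by simp)
  rw [stepsFrom, this, add_zero]

lemma stepsFrom_inj {i : Fin (m + 1)} {j k : ℕ} (hj : j ≤ m) (hk : k ≤ m)
    (h : stepsFrom i j = stepsFrom i k) : j = k := by
  have := congrArg Fin.val (add_left_cancel h)
  rwa [Fin.val_ofNat, Fin.val_ofNat, Nat.mod_eq_of_lt (by omega),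
    Nat.mod_eq_of_lt (by omega)] at this

lemma exists_stepsFrom_eq (i j : Fin (m + 1)) : ∃ k ≤ m, stepsFrom i k = j :=
  ⟨(j - i).val, Nat.lt_succ_iff.1 (j - i).2, by simp [stepsFrom]⟩

lemma exists_lt_stepsFrom_eq_iff {i j : Fin (m + 1)} :
    (∃ k < m, stepsFrom i k = j) ↔ j ≠ stepsFrom i m := by
  constructor
  · rintro ⟨k, hk, rfl⟩ h
    have := stepsFrom_inj hk.le le_rfl h
    omega
  · intro h
    obtain ⟨k, hk, rfl⟩ := exists_stepsFrom_eq i j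
    exact ⟨k, lt_of_le_of_ne hk fun hkm => h (congrArg (stepsFrom i) hkm), rfl⟩

lemma exists_lt_stepsFrom_succ_eq_iff {i j : Fin (m + 1)} :
    (∃ k < m, stepsFrom i (k + 1) = j) ↔ j ≠ i := by
  constructor
  · rintro ⟨k, hk, rfl⟩ h
    have := stepsFrom_inj (i := i) (j := k + 1) (k := 0) hk (Nat.zero_le m)
      (h.trans (stepsFrom_zero i).symm)
    omega
  · intro h
    obtain ⟨k, hk, rfl⟩ := exists_stepsFrom_eq i j
    cases k with
    | zero => exact absurd (stepsFrom_zero i) h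
    | succ k => exact ⟨k, hk, rfl⟩

/-- The ends of the edges of the circular ladder. -/
def LadderEdge.ends {n : ℕ} : LadderEdge n → (Fin n × Bool) × (Fin n × Bool)
  | .rail i ε => ((i, ε), (finRotate n i, ε))
  | .spoke i => ((i, true), (i, false))

/-- The edges that lead from one of the columns `a, …, a + k - 1` after `i` to the next column, and
the spokes in the columns which they reach. -/
def stepEdges {m : ℕ} (i : Fin (m + 1)) (a k : ℕ) : List (LadderEdge (m + 1)) :=
  (List.range' a k).flatMap fun j => [.rail (stepsFrom i j) true, .rail (stepsFrom i j) false,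
    .spoke (stepsFrom i (j + 1))]

/-- The columns `a, …, a + k - 1` after `i`, with vertices labelled by `g`. -/
def columnsFrom {m : ℕ} {γ : Type*} (g : Fin (m + 1) × Bool → γ) (i : Fin (m + 1)) (a k : ℕ) :
    List (γ × γ) :=
  (List.range' a k).map fun j => (g (stepsFrom i j, true), g (stepsFrom i j, false))

lemma length_columnsFrom (g : Fin (m + 1) × Bool → γ) (i : Fin (m + 1)) (a k : ℕ) :
    (columnsFrom g i a k).length = k := by
  simp [columnsFrom]

lemma rail_mem_stepEdges {i j : Fin (m + 1)} {ε : Bool} :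
    .rail j ε ∈ stepEdges i 0 m ↔ j ≠ stepsFrom i m := by
  rw [← exists_lt_stepsFrom_eq_iff]
  cases ε <;> simp [stepEdges, eq_comm]

lemma spoke_mem_stepEdges {i j : Fin (m + 1)} : .spoke j ∈ stepEdges i 0 m ↔ j ≠ i := by
  rw [← exists_lt_stepsFrom_succ_eq_iff]
  simp [stepEdges, eq_comm]

lemma nodup_stepEdges (i : Fin (m + 1)) : (stepEdges i 0 m).Nodup := by
  rw [stepEdges, List.nodup_flatMap]
  refine ⟨fun j _ => by simp, ?_⟩
  refine List.Nodup.pairwise_of_forall_ne List.nodup_range' fun j hj k hk hjk => ?_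
  simp only [List.mem_range'_1] at hj hk
  have h1 : stepsFrom i j ≠ stepsFrom i k := fun h => hjk (stepsFrom_inj (by omega) (by omega) h)
  have h2 : stepsFrom i (j + 1) ≠ stepsFrom i (k + 1) := fun h => by
    have := stepsFrom_inj (by omega) (by omega) h
    omega
  simp [Function.onFun, h1.symm, h2.symm]

/-- Serves both graphs: `g = id` without a closing vertex for the ladder, and the quotient map with
the contracted vertex as `t` for the circular ladder. -/
lemma map_stepEdges_append (g : Fin (m + 1) × Bool → γ) (i : Fin (m + 1)) (a k : ℕ)
    (t : Option γ) :
    (stepEdges i a k).map (Prod.map g g ∘ LadderEdge.ends) ++ ladderChain t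
        (g (stepsFrom i (a + k), true)) (g (stepsFrom i (a + k), false)) [] =
      ladderChain t (g (stepsFrom i a, true)) (g (stepsFrom i a, false))
        (columnsFrom g i (a + 1) k) := by
  induction k generalizing a with
  | zero => simp [stepEdges, columnsFrom]
  | succ k ih =>
    have := ih (a + 1)
    rw [show a + 1 + k = a + (k + 1) by omega] at this
    simp only [stepEdges, columnsFrom, List.range'_succ, List.flatMap_cons, List.map_cons,
      ladderChain, List.cons_append, List.nil_append] at this ⊢
    rw [this]
    simp [LadderEdge.ends, stepsFrom_succ]

lemma mem_columnVertices_columnsFrom {g : Fin (m + 1) × Bool → γ} {i : Fin (m + 1)} {x : γ} :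
    x ∈ columnVertices (columnsFrom g i 1 m) ↔ ∃ u : Fin (m + 1) × Bool, u.1 ≠ i ∧ g u = x := by
  simp only [columnVertices, columnsFrom, List.mem_flatMap, List.mem_map, List.mem_range'_1,
    List.mem_cons, List.not_mem_nil, or_false]
  constructor
  · rintro ⟨_, ⟨k, hk, rfl⟩, hx⟩
    have hki : stepsFrom i k ≠ i := fun h => by
      have := stepsFrom_inj (i := i) (j := k) (k := 0) (by omega) (Nat.zero_le m)
        (h.trans (stepsFrom_zero i).symm)
      omega
    rcases hx with rfl | rfl
    · exact ⟨(stepsFrom i k, true), hki, rfl⟩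
    · exact ⟨(stepsFrom i k, false), hki, rfl⟩
  · rintro ⟨⟨j, ε⟩, hj, rfl⟩
    obtain ⟨k, hk, rfl⟩ := exists_lt_stepsFrom_succ_eq_iff.2 hj
    refine ⟨_, ⟨k + 1, by omega, rfl⟩, ?_⟩
    cases ε <;> simp

lemma nodup_columnVertices_columnsFrom {g : Fin (m + 1) × Bool → γ} {i : Fin (m + 1)}
    (hg : ∀ u w : Fin (m + 1) × Bool, u.1 ≠ i → g u = g w → u = w) :
    (columnVertices (columnsFrom g i 1 m)).Nodup := by
  have hne : ∀ k, 1 ≤ k ∧ k < 1 + m → stepsFrom i k ≠ i := fun k hk h => by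
    have := stepsFrom_inj (i := i) (j := k) (k := 0) (by omega) (Nat.zero_le m)
      (h.trans (stepsFrom_zero i).symm)
    omega
  rw [columnVertices, columnsFrom, List.flatMap_map, List.nodup_flatMap]
  refine ⟨fun j hj => ?_, ?_⟩
  · rw [List.mem_range'_1] at hj
    have : g (stepsFrom i j, true) ≠ g (stepsFrom i j, false) := fun h => by
      simpa using hg _ _ (hne j hj) h
    simpa using this
  refine List.Nodup.pairwise_of_forall_ne List.nodup_range' fun j hj k hk hjk => ?_
  rw [List.mem_range'_1] at hj hk
  have key : ∀ ε δ, g (stepsFrom i j, ε) ≠ g (stepsFrom i k, δ) := fun ε δ h =>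
    hjk (stepsFrom_inj (by omega) (by omega) (Prod.ext_iff.1 (hg _ _ (hne j hj) h)).1)
  simp [Function.onFun, (key _ _).symm]

end CircularColumns

/-! ### The two families of ladders -/

section Ladders

variable {m : ℕ}

lemma ladder_isLink_iff {e : LadderEdge (m + 1)} {x y : Fin (m + 1) × Bool} :
    (ladder (m + 1)).IsLink e x y ↔
      e ∈ .spoke 0 :: stepEdges 0 0 m ∧ s(x, y) = s(e.ends.1, e.ends.2) := by
  rcases e with ⟨j, ε⟩ | j
  · have hlast : stepsFrom (0 : Fin (m + 1)) m = Fin.last m := Fin.ext (by simp [stepsFrom])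
    have hmem : (.rail j ε ∈ (.spoke 0 :: stepEdges 0 0 m : List (LadderEdge (m + 1)))) ↔
        j ≠ Fin.last m := by
      rw [List.mem_cons, rail_mem_stepEdges, hlast]
      simp
    rw [hmem]
    change (∃ k : Fin (m + 1), k.val = j.val + 1 ∧ s(x, y) = s((j, ε), (k, ε))) ↔
      _ ∧ s(x, y) = s((j, ε), (finRotate (m + 1) j, ε))
    constructor
    · rintro ⟨k, hk, h⟩
      have hj : j.val < m := by omega
      have : finRotate (m + 1) j = k := by
        rw [finRotate_of_lt hj]
        exact Fin.ext hk.symm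
      rw [this]
      refine ⟨fun hj' => ?_, h⟩
      simp [hj'] at hj
    · rintro ⟨hj, h⟩
      have hj' : j.val < m := Fin.val_lt_last hj
      refine ⟨finRotate (m + 1) j, ?_, h⟩
      rw [finRotate_of_lt hj']
  · have hmem : .spoke j ∈ (.spoke 0 :: stepEdges 0 0 m : List (LadderEdge (m + 1))) := by
      rw [List.mem_cons, spoke_mem_stepEdges]
      by_cases hj : j = 0 <;> simp [hj]
    exact (and_iff_right hmem).symm

theorem numSpanningTrees_ladder (m : ℕ) :
    ((ladder (m + 1)).numSpanningTrees : ℤ) = ladderSeq (m + 1) := by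
  have hg : ∀ u w : Fin (m + 1) × Bool, u.1 ≠ 0 → id u = id w → u = w := fun _ _ _ h => h
  have hnotMem : ∀ ε, (0, ε) ∉ columnVertices (columnsFrom (id (α := Fin (m + 1) × Bool)) 0 1 m) :=
    fun ε h => by
      obtain ⟨u, hu, rfl⟩ := mem_columnVertices_columnsFrom.1 h
      exact hu rfl
  have hmap := map_stepEdges_append (id (α := Fin (m + 1) × Bool)) 0 0 m none
  rw [stepsFrom_zero] at hmap
  simp only [ladderChain, Option.toList_none, List.flatMap_nil, List.append_nil, Prod.map_id,
    Function.id_comp, id_eq, zero_add] at hmap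
  rw [Graph.numSpanningTrees_eq_treeCount (X := Finset.univ) (d := LadderEdge.ends)
    (by simp [ladder]) Finset.univ_nonempty (.spoke 0 :: stepEdges 0 0 m)
    (List.nodup_cons.2 ⟨fun h => spoke_mem_stepEdges.1 h rfl, nodup_stepEdges 0⟩)
    fun e x y => ladder_isLink_iff, List.map_cons, hmap]
  have hc := nodup_columnVertices_columnsFrom hg
  obtain ⟨h1, h2⟩ := treeCount_ladderChain_none hc (hnotMem true)
  have h2 := h2 _ (hnotMem false) (by simp)
  have hcard : (Finset.univ : Finset (Fin (m + 1) × Bool)).card = 2 * m + 2 := by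
    simp; omega
  rw [length_columnsFrom] at h1 h2
  rw [hcard]
  change (treeCount _ (((0, true), (0, false)) :: _) : ℤ) = _
  rw [treeCount_spoke_ladderChain (by simp) (hnotMem false)]
  push_cast
  rw [h2]
  change _ + (treeCount (2 * m + 1) _ : ℤ) = _
  rw [Option.map_none, h1]
  ring

/-- The map sending column `i` to `(i, true)` and fixing all other vertices factors through the
quotient, so nothing outside that column is identified. -/
lemma quot_mk_spoke_inj {n : ℕ} {i : Fin n} {u w : Fin n × Bool} (hu : u.1 ≠ i)
    (h : Quot.mk ((circularLadder n).IsLink (.spoke i)) u = Quot.mk _ w) : u = w := by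
  let f : Quot ((circularLadder n).IsLink (.spoke i)) → Fin n × Bool :=
    Quot.lift (fun u => if u.1 = i then (i, true) else u) fun a b hab => by
      have hab : s(a, b) = s((i, true), (i, false)) := hab
      rcases Sym2.eq_iff.1 hab with ⟨rfl, rfl⟩ | ⟨rfl, rfl⟩ <;> simp
  have hf : (if u.1 = i then (i, true) else u) = if w.1 = i then (i, true) else w :=
    congrArg f h
  rw [if_neg hu] at hf
  split_ifs at hf with hw
  · exact absurd (congrArg Prod.fst hf) hu
  · exact hf

lemma circularLadder_isLink_iff {n : ℕ} {e : LadderEdge n} {x y : Fin n × Bool} :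
    (circularLadder n).IsLink e x y ↔ s(x, y) = s(e.ends.1, e.ends.2) := by
  cases e <;> rfl

theorem numSpanningTrees_contractEdge_circularLadder (i : Fin (m + 1)) :
    (((circularLadder (m + 1)).contractEdge (.spoke i)).numSpanningTrees : ℤ) =
      (m + 1) * ladderSeq (m + 1) := by
  classical
  set g := Quot.mk ((circularLadder (m + 1)).IsLink (.spoke i))
  have hgi : g (i, false) = g (i, true) := (Quot.sound (circularLadder_isLink_iff.2 rfl)).symm
  have hg : ∀ u w : Fin (m + 1) × Bool, u.1 ≠ i → g u = g w → u = w :=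
    fun u w hu h => quot_mk_spoke_inj hu h
  have hc := nodup_columnVertices_columnsFrom hg
  have hv : g (i, true) ∉ columnVertices (columnsFrom g i 1 m) := fun h => by
    obtain ⟨u, hu, h⟩ := mem_columnVertices_columnsFrom.1 h
    exact hu (congrArg Prod.fst (hg u _ hu h))
  set X := (g (i, true) :: columnVertices (columnsFrom g i 1 m)).toFinset with hX
  have hcard : X.card = 2 * m + 1 := by
    rw [hX, List.toFinset_card_of_nodup (List.nodup_cons.2 ⟨hv, hc⟩), List.length_cons,
      length_columnVertices, length_columnsFrom]
  have hV : ((circularLadder (m + 1)).contractEdge (.spoke i)).vertexSet = X := by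
    change g '' Set.univ = X
    ext x
    simp only [hX, Set.image_univ, Set.mem_range, List.coe_toFinset, List.mem_cons,
      Set.mem_ofPred_eq, mem_columnVertices_columnsFrom]
    constructor
    · rintro ⟨⟨j, ε⟩, rfl⟩
      by_cases hj : j = i
      · subst hj
        cases ε
        · exact Or.inl hgi
        · exact Or.inl rfl
      · exact Or.inr ⟨_, hj, rfl⟩
    · rintro (rfl | ⟨u, -, rfl⟩)
      · exact ⟨_, rfl⟩
      · exact ⟨_, rfl⟩
  -- The two appended rails lead back to column `i`; for `m = 0` they are the two loops.
  set l : List (LadderEdge (m + 1)) := stepEdges i 0 m ++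
    [.rail (stepsFrom i m) true, .rail (stepsFrom i m) false] with hl
  have hmem : ∀ e, e ∈ l ↔ e ≠ .spoke i := by
    rintro (⟨j, ε⟩ | j)
    · rw [hl, List.mem_append, rail_mem_stepEdges]
      by_cases hj : j = stepsFrom i m
      · cases ε <;> simp [hj]
      · simp [hj]
    · rw [hl, List.mem_append, spoke_mem_stepEdges]
      simp
  have hnodup : l.Nodup := by
    refine List.Nodup.append (nodup_stepEdges i) (by simp) ?_
    intro e he he'
    simp only [List.mem_cons, List.not_mem_nil, or_false] at he'
    rcases he' with rfl | rfl <;> exact rail_mem_stepEdges.1 he rfl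
  have hlink : ∀ e x y, ((circularLadder (m + 1)).contractEdge (.spoke i)).IsLink e x y ↔
      e ∈ l ∧ s(x, y) = s(((Prod.map g g ∘ LadderEdge.ends) e).1,
        ((Prod.map g g ∘ LadderEdge.ends) e).2) := by
    intro e x y
    rw [hmem]
    simp only [Graph.contractEdge, Graph.map_isLink, Relation.Map, Graph.deleteEdges_isLink,
      circularLadder_isLink_iff, Set.mem_singleton_iff, Function.comp_apply, Prod.map_fst,
      Prod.map_snd]
    constructor
    · rintro ⟨u, w, ⟨h, he⟩, rfl, rfl⟩
      exact ⟨he, by simpa using congrArg (Sym2.map g) h⟩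
    · rintro ⟨he, h⟩
      rcases Sym2.eq_iff.1 h with ⟨rfl, rfl⟩ | ⟨rfl, rfl⟩
      · exact ⟨_, _, ⟨rfl, he⟩, rfl, rfl⟩
      · exact ⟨_, _, ⟨Sym2.eq_swap, he⟩, rfl, rfl⟩
  have hmap : l.map (Prod.map g g ∘ LadderEdge.ends) =
      ladderChain (some (g (i, true))) (g (i, true)) (g (i, true)) (columnsFrom g i 1 m) := by
    have h := map_stepEdges_append g i 0 m (some (g (i, true)))
    rw [stepsFrom_zero, hgi, zero_add, zero_add] at h
    rw [← h, hl, List.map_append]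
    have hi : finRotate (m + 1) (stepsFrom i m) = i := by rw [← stepsFrom_succ, stepsFrom_self]
    simp only [ladderChain, LadderEdge.ends, hi, hgi, List.map_cons, List.map_nil,
      Function.comp_apply, Prod.map_apply, Option.toList_some, List.flatMap_singleton]
  rw [Graph.numSpanningTrees_eq_treeCount hV ⟨g (i, true), by simp [hX]⟩ l hnodup hlink, hmap,
    hcard]
  have := (treeCount_ladderChain_some hc hv).1
  rwa [length_columnsFrom] at this

end Ladders

theorem mainTheorem4 (n : ℕ) (i : Fin n) :
    ((circularLadder n).contractEdge (LadderEdge.spoke i)).numSpanningTrees =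
        n * (ladder n).numSpanningTrees ∧
      ((ladder n).numSpanningTrees : ℤ) = ladderSeq n := by
  cases n with
  | zero => exact i.elim0
  | succ m =>
    refine ⟨?_, numSpanningTrees_ladder m⟩
    have := numSpanningTrees_contractEdge_circularLadder i
    rw [← numSpanningTrees_ladder] at this
    exact_mod_cast this
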